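/- **Setting.** Let $M=(S,T)$ be a Markov decision process: $S$ is a finite set of states, $T$ is a finite set of transitions $\mu=(s,d)$ with $s\in S$ (the state $\mathrm{st}(\mu)=s$ in which $\mu$ is enabled) and $d$ a probability distribution on $S$ (write $\mu(t)=d(t)$), and every state enables at least one transition. A scheduler $\eta$ chooses for every state $s$ a transition $\eta(s)\in T$ enabled in $s$; $\Pr^\eta_s(\mathrm{reach}\,U)$ is the probability that a path from $s$ under $\eta$ visits the target set $U\subseteq S$. Let $v_s=\max_\eta \Pr^\eta_s(\mathrm{reach}\,U)$ ($v_s=\min_\eta\Pr^\eta_s(\mathrm{reach}\,U)$, resp.). The maybe states are $S^?=\{s\in S\setminus U : v_s\neq 0\}$; put $n=|S^?|$, and let $T^?$ be the set of transitions enabled in maybe states, $m=|T^?|$. A scheduler $\eta$ is *apt* if $\Pr^\eta_s(\mathrm{reach}\,U)>0$ for all $s\in S^?$, and *optimal* if $\Pr^\eta_s(\mathrm{reach}\,U)=v_s$ for all $s\in S$. Let $A$ be the $T^?\times S^?$ matrix with $A_{\mu,s}=\mu(s)-1$ if $s=\mathrm{st}(\mu)$ and $A_{\mu,s}=\mu(s)$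 otherwise, and let $b_\mu=-\sum_{s\in U}\mu(s)$. Let $\mathcal L$ be the linear program in the variables $x=(x_s)_{s\in S^?},(x_\mu)_{\mu\in T^?}$ $$\min\Big\{\textstyle\sum_{s\in S^?}x_s \;\Big|\; (A\mid I)x=b,\ x\ge 0\Big\}\qquad\Big(\min\Big\{-\textstyle\sum_{s\in S^?}x_s\;\Big|\;(-A\mid I)x=-b,\ x\ge 0\Big\},\text{ resp.}\Big).$$ A set $B$ of columns of the constraint matrix is a *basis* if the submatrix with these columns (also written $B$) is square and non-singular. It induces the solution with $x^B=B^{-1}b'$ and $x_k=0$ for $k\notin B$, where $b'$ is the constraint vector of $\mathcal L$. It is *feasible* if this solution is $\ge 0$ and satisfies the constraints, and *dual feasible* if $c_k-c^BB^{-1}\mathcal A_k\ge 0$ for all $k\notin B$, where $c$ is the cost vector and $\mathcal A_k$ is the $k$-th column of the constraint matrix. For a scheduler $\eta$ let $B_\eta$ consist of the columns of all $s\in S^?$ and of all $\mu\in T^?$ with $\eta(\mathrm{st}(\mu))\neq\mu$. **Algorithm.** Given $M$, $U$ and the scheduler $\eta$ provided by the model checker, construct $\mathcal L$ and $B_\eta$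 and start an exact simplex solver for $\mathcal L$ at $B_\eta$. If $B_\eta$ is not a basis, the solver reports that it is singular and the algorithm reports an error. Otherwise in each iteration the solver checks whether the current basis is feasible and dual feasible; if so, it finishes and the algorithm returns the induced solution; if not, the solver moves to another basis, chosen by an arbitrary rule that may depend on the bases visited so far. **Theorem.** For the maximum as well as for the minimum, and for every rule of the solver: 1. If the algorithm returns a value $x$, then $x_s=v_s$ for all $s\in S^?$. 2. If $\eta$ is apt, then $B_\eta$ is a basis; the algorithm does not report an error; every value that it returns is an optimal solution of $\mathcal L$; and it does return a value if the solver explores different bases, that is, if it moves to a basis not visited before as long as there is one. 3. If $\eta$ is optimal, then $B_\eta$ is a basis that is both feasible and dual feasible, so that the simplex solver finishes in the first iteration: the outcome of the algorithm is the solution induced by $B_\eta$, without any move to another basis. -/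

import Mathlib

/-! ### Markov decision processes and reachability probabilities -/

/-- A Markov decision process over the finite set `S` of states: a finite set of transitions
`μ = (s, d)`, where `s` is the state in which `μ` is enabled and `d` is a probability distribution
on the states, such that every state enables at least one transition. -/
structure MDP (S : Type*) where
  trans : Finset (S × PMF S)
  exists_enabled : ∀ s, ∃ μ ∈ trans, μ.1 = s

/-- A (Markovian, non-randomized) scheduler chooses an enabled transition in every state. -/
structure MDP.Scheduler {S : Type*} (M : MDP S) where
  choice : S → S × PMF S
  choice_mem : ∀ s, choice s ∈ M.trans
  choice_source : ∀ s, (choice s).1 = s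

namespace MDP

variable {S : Type*} [Fintype S] [MeasurableSpace S] [DiscreteMeasurableSpace S] {M : MDP S}

/-- The distribution of the state at time `n + 1` given the states at times `0, …, n`, under the
scheduler `η`: it is the distribution of the transition that `η` chooses in the state at time
`n`. -/
noncomputable def Scheduler.step (η : M.Scheduler) (n : ℕ) :
    ProbabilityTheory.Kernel ((i : Finset.Iic n) → (fun _ : ℕ => S) i) S where
  toFun h := (η.choice (h ⟨n, Finset.mem_Iic.2 le_rfl⟩)).2.toMeasure
  measurable' := measurable_of_finite _

instance (η : M.Scheduler) (n : ℕ) : ProbabilityTheory.IsMarkovKernel (η.step n) :=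
  ⟨fun h => PMF.toMeasure.isProbabilityMeasure (η.choice (h ⟨n, Finset.mem_Iic.2 le_rfl⟩)).2⟩

/-- The probability measure on infinite paths from `s` under the scheduler `η`. Under `η` the
transitions of a path are determined by its states (the one taken from `t` is `η t`), so that a
path is given by its sequence of states. The lemma `pathMeasure_cylinder` shows that the paths that
extend a given finite path have the product of the transition probabilities as their measure. -/
noncomputable def Scheduler.pathMeasure (η : M.Scheduler) (s : S) :
    MeasureTheory.Measure (ℕ → S) :=
  ProbabilityTheory.Kernel.traj (X := fun _ => S) η.step 0 (fun _ => s)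

open MeasureTheory ProbabilityTheory in
/-- The paths that start with `a 0, …, a n` have the product of the transition probabilities along
`a` as their measure. -/
theorem Scheduler.pathMeasure_cylinder (η : M.Scheduler) (s : S) (a : ℕ → S) (ha : a 0 = s)
    (n : ℕ) : η.pathMeasure s {ω | ∀ i ≤ n, ω i = a i} =
      ∏ i ∈ Finset.range n, (η.choice (a i)).2 (a (i + 1)) := by
  have key : ∀ n, {ω : ℕ → S | ∀ i ≤ n, ω i = a i} =
      Preorder.frestrictLe (π := fun _ => S) n ⁻¹' {Preorder.frestrictLe n a} := by
    intro n
    ext ω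
    simp only [Set.mem_ofPred_eq, Set.mem_preimage, Set.mem_singleton_iff, funext_iff]
    constructor
    · rintro h ⟨i, hi⟩
      exact h i (Finset.mem_Iic.1 hi)
    · intro h i hi
      exact h ⟨i, Finset.mem_Iic.2 hi⟩
  have hm : ∀ n, η.pathMeasure s {ω | ∀ i ≤ n, ω i = a i} =
      Kernel.partialTraj (X := fun _ => S) η.step 0 n (fun _ => s) {Preorder.frestrictLe n a} := by
    intro n
    rw [key, Scheduler.pathMeasure, ← Kernel.traj_map_frestrictLe,
      Kernel.map_apply' _ (by fun_prop) _ (measurableSet_singleton _)]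
  have hE : ∀ n, MeasurableSet (IicProdIoc (X := fun _ => S) n (n + 1) ⁻¹'
      {Preorder.frestrictLe (n + 1) a}) :=
    fun n => measurable_IicProdIoc (measurableSet_singleton _)
  rw [hm]
  induction n with
  | zero =>
    rw [Kernel.partialTraj_self, Kernel.id_apply, Finset.range_zero, Finset.prod_empty,
      Measure.dirac_apply' _ (measurableSet_singleton _), Set.indicator_of_mem]
    · rfl
    · rw [Set.mem_singleton_iff]
      funext ⟨i, hi⟩
      have : i = 0 := by simpa using hi
      subst this
      exact ha.symm
  | succ n ih =>
    have hstep : ∀ y : (i : Finset.Iic n) → (fun _ : ℕ => S) i,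
        Kernel.partialTraj (X := fun _ => S) η.step n (n + 1) y {Preorder.frestrictLe (n + 1) a} =
        ({Preorder.frestrictLe (π := fun _ => S) n a} : Set _).indicator
          (fun _ => (η.choice (a n)).2 (a (n + 1))) y := by
      intro y
      rw [Kernel.partialTraj_succ_self,
        Kernel.map_apply' _ (by fun_prop) _ (measurableSet_singleton _),
        Kernel.id_prod_apply' _ _ (hE n), Kernel.map_apply' _
          (MeasurableEquiv.piSingleton (X := fun _ => S) n).measurable _
          (measurable_prodMk_left (hE n))]
      change (η.choice (y ⟨n, Finset.mem_Iic.2 le_rfl⟩)).2.toMeasure _ = _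
      by_cases hy : y = Preorder.frestrictLe (π := fun _ => S) n a
      · rw [Set.indicator_of_mem (by simpa using hy), hy]
        change (η.choice (a n)).2.toMeasure _ = _
        rw [← PMF.toMeasure_apply_singleton _ _ (measurableSet_singleton _)]
        congr 1
        ext t
        simp only [Set.mem_preimage, Set.mem_singleton_iff]
        constructor
        · intro h
          have := congrFun h ⟨n + 1, Finset.mem_Iic.2 le_rfl⟩
          simpa [IicProdIoc, MeasurableEquiv.piSingleton] using this
        · rintro rfl
          funext ⟨i, hi⟩
          rcases Nat.lt_or_ge n i with h | h
          · have : i = n + 1 := le_antisymm (Finset.mem_Iic.1 hi) h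
            subst this
            simp [IicProdIoc, MeasurableEquiv.piSingleton]
          · simp [IicProdIoc, h]
      · rw [Set.indicator_of_notMem (by simpa using hy)]
        convert measure_empty (μ := (η.choice (y ⟨n, Finset.mem_Iic.2 le_rfl⟩)).2.toMeasure)
        refine Set.eq_empty_of_forall_notMem fun t ht => hy ?_
        funext ⟨i, hi⟩
        have := congrFun ht ⟨i, Finset.mem_Iic.2 ((Finset.mem_Iic.1 hi).trans n.le_succ)⟩
        simpa [IicProdIoc, Finset.mem_Iic.1 hi] using this
    rw [Kernel.partialTraj_succ_eq_comp (Nat.zero_le n),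
      Kernel.comp_apply' _ _ _ (measurableSet_singleton _)]
    simp_rw [hstep]
    rw [lintegral_indicator (measurableSet_singleton _), setLIntegral_const, ih,
      Finset.prod_range_succ, mul_comm]

/-- The probability of reaching the set `U` from `s` under the scheduler `η`. -/
noncomputable def Scheduler.reachProb (η : M.Scheduler) (U : Set S) (s : S) : ℝ :=
  (η.pathMeasure s).real {ω | ∃ i, ω i ∈ U}

end MDP

/-- Whether maximum or minimum reachability probabilities are sought. -/
inductive Objective
  | max
  | min

/-- `1` for the maximum and `-1` for the minimum. -/
def Objective.sign : Objective → ℝ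
  | .max => 1
  | .min => -1

namespace MDP

variable {S : Type*} [Fintype S] [MeasurableSpace S] [DiscreteMeasurableSpace S]

/-- The maximum (minimum, resp.) over all schedulers of the probability of reaching `U` from `s`. -/
noncomputable def optProb (M : MDP S) (o : Objective) (U : Set S) (s : S) : ℝ :=
  match o with
  | .max => ⨆ η : M.Scheduler, η.reachProb U s
  | .min => ⨅ η : M.Scheduler, η.reachProb U s

/-- The scheduler `η` attains the maximum (minimum, resp.) in all states. -/
def Scheduler.IsOptimal {M : MDP S} (η : M.Scheduler) (o : Objective) (U : Set S) : Prop :=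
  ∀ s, η.reachProb U s = M.optProb o U s

/-- The maybe states: those outside `U` whose maximum (minimum, resp.) probability of reaching `U`
is not `0`. -/
def maybeStates (M : MDP S) (o : Objective) (U : Set S) : Set S :=
  ({s | M.optProb o U s = 0} ∪ U)ᶜ

/-- A scheduler is apt if it reaches `U` with positive probability from all maybe states. -/
def Scheduler.IsApt {M : MDP S} (η : M.Scheduler) (o : Objective) (U : Set S) : Prop :=
  ∀ s ∈ M.maybeStates o U, 0 < η.reachProb U s

end MDP

/-! ### Linear programs in the form `min {c x | A x = b, x ≥ 0}` -/

/-- A linear program with constraint matrix `A`, constraint vector `b` and cost vector `c`; the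
rows are indexed by `ι` and the columns by `κ`. -/
structure LinProg (ι κ : Type*) where
  A : Matrix ι κ ℝ
  b : ι → ℝ
  c : κ → ℝ

namespace LinProg

open scoped Matrix

variable {ι κ : Type*} [Fintype ι] [Fintype κ]

def IsFeasible (P : LinProg ι κ) (x : κ → ℝ) : Prop :=
  P.A *ᵥ x = P.b ∧ ∀ k, 0 ≤ x k

def IsOptimal (P : LinProg ι κ) (x : κ → ℝ) : Prop :=
  P.IsFeasible x ∧ ∀ y, P.IsFeasible y → P.c ⬝ᵥ x ≤ P.c ⬝ᵥ y

/-- The submatrix of `A` that consists of the columns in `B`. -/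
def cols (P : LinProg ι κ) (B : Finset κ) : Matrix ι B ℝ :=
  P.A.submatrix id Subtype.val

open Classical in
/-- The set of columns `B` is a basis: the submatrix of `A` with these columns is non-singular,
that is, it has a two-sided inverse (which forces it to be square). -/
def IsBasis (P : LinProg ι κ) (B : Finset κ) : Prop :=
  ∃ C : Matrix B ι ℝ, P.cols B * C = 1 ∧ C * P.cols B = 1

/-- The bases of a linear program. -/
abbrev Basis (P : LinProg ι κ) : Type _ := {B : Finset κ // P.IsBasis B}

/-- The inverse `B⁻¹` of the submatrix that belongs to a basis. -/
noncomputable def Basis.inv {P : LinProg ι κ} (B : P.Basis) : Matrix B.1 ι ℝ := B.2.choose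

open Classical in
/-- The solution induced by a basis: `B⁻¹ b` on the columns in `B`, and `0` elsewhere. -/
noncomputable def Basis.solution {P : LinProg ι κ} (B : P.Basis) (k : κ) : ℝ :=
  if h : k ∈ B.1 then (B.inv *ᵥ P.b) ⟨k, h⟩ else 0

/-- The reduced cost `c_k - c^B B⁻¹ A_k`. -/
noncomputable def Basis.reducedCost {P : LinProg ι κ} (B : P.Basis) (k : κ) : ℝ :=
  P.c k - ((fun j : B.1 => P.c j) ᵥ* B.inv) ⬝ᵥ (fun i => P.A i k)

def Basis.IsFeasible {P : LinProg ι κ} (B : P.Basis) : Prop := P.IsFeasible B.solution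

def Basis.IsDualFeasible {P : LinProg ι κ} (B : P.Basis) : Prop :=
  ∀ k, k ∉ B.1 → 0 ≤ B.reducedCost k

/-! ### The simplex method from a given starting basis -/

/-- A rule by which a simplex solver moves from a basis to the next one. It may depend on the
current basis and on the list of the bases visited before it, so that primal and dual variants and
all choices of the entering and leaving variables are covered. -/
abbrev PivotRule (P : LinProg ι κ) : Type _ := P.Basis → List P.Basis → P.Basis

/-- The rule explores different bases: as long as there is a basis that has not been visited yet,
it moves to such a basis. -/
def PivotRule.IsNonRepeating {P : LinProg ι κ} (rule : P.PivotRule) : Prop :=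
  ∀ B past, (∃ B', B' ∉ B :: past) → rule B past ∉ B :: past

/-- `rule.Run B past x k`: the solver, when it is at the basis `B` and has visited the bases in
`past` before, finishes with the solution `x` after `k` further iterations. In each iteration the
solver checks whether the current basis is feasible and dual feasible. If so, it finishes with the
induced solution, otherwise it moves to the next basis. -/
inductive PivotRule.Run {P : LinProg ι κ} (rule : P.PivotRule) :
    P.Basis → List P.Basis → (κ → ℝ) → ℕ → Prop
  | finish (B : P.Basis) (past : List P.Basis) :
      B.IsFeasible → B.IsDualFeasible → Run rule B past B.solution 1
  | move (B : P.Basis) (past : List P.Basis) (x : κ → ℝ) (k : ℕ) :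
      ¬ (B.IsFeasible ∧ B.IsDualFeasible) → Run rule (rule B past) (B :: past) x k →
      Run rule B past x (k + 1)

/-- What a solver, and the algorithm that calls it, can report: a solution together with the number
of iterations, or the error that the starting basis is singular. -/
inductive Outcome (κ : Type*)
  | value (x : κ → ℝ) (iterations : ℕ)
  | singular

/-- The outcome of the simplex solver that is started with the set `B` of columns. A solver that
runs forever has no outcome. -/
inductive PivotRule.Solves {P : LinProg ι κ} (rule : P.PivotRule) (B : Finset κ) :
    Outcome κ → Prop
  | value (hB : P.IsBasis B) (x : κ → ℝ) (k : ℕ) :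
      rule.Run ⟨B, hB⟩ [] x k → Solves rule B (.value x k)
  | singular : ¬ P.IsBasis B → Solves rule B .singular

end LinProg

/-! ### The linear program of a reachability problem, the basis of a scheduler, the algorithm -/

namespace MDP

variable {S : Type*} [Fintype S] [MeasurableSpace S] [DiscreteMeasurableSpace S]

/-- The maybe states, as a type. -/
abbrev Maybe (M : MDP S) (o : Objective) (U : Set S) : Type _ := {s : S // s ∈ M.maybeStates o U}

/-- The transitions that are enabled in maybe states; they index the rows and the slack
variables. -/
abbrev Row (M : MDP S) (o : Objective) (U : Set S) : Type _ :=
  {μ : M.trans // μ.1.1 ∈ M.maybeStates o U}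

/-- The columns: one for each maybe state, one (slack variable) for each row. -/
abbrev Col (M : MDP S) (o : Objective) (U : Set S) : Type _ := M.Maybe o U ⊕ M.Row o U

noncomputable instance (M : MDP S) (o : Objective) (U : Set S) : Fintype (M.Maybe o U) :=
  Fintype.ofFinite _

noncomputable instance (M : MDP S) (o : Objective) (U : Set S) : Fintype (M.Row o U) :=
  Fintype.ofFinite _

open Classical in
/-- The matrix with entries `μ(s) - 1` if `μ` is enabled in `s`, and `μ(s)` otherwise. -/
noncomputable def coeffs (M : MDP S) (o : Objective) (U : Set S) :
    Matrix (M.Row o U) (M.Maybe o U) ℝ :=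
  Matrix.of fun μ s => (μ.1.1.2 s.1).toReal - if s.1 = μ.1.1.1 then 1 else 0

open Classical in
/-- The vector with entries `-∑_{s ∈ U} μ(s)`. -/
noncomputable def rhs (M : MDP S) (o : Objective) (U : Set S) : M.Row o U → ℝ :=
  fun μ => -∑ s : S with s ∈ U, (μ.1.1.2 s).toReal

open Classical in
/-- The linear program `min {(1, 0) x | (A | I) x = b, x ≥ 0}` for the maximum, and
`min {-(1, 0) x | (-A | I) x = -b, x ≥ 0}` for the minimum. -/
noncomputable def linProg (M : MDP S) (o : Objective) (U : Set S) :
    LinProg (M.Row o U) (M.Col o U) where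
  A := Matrix.fromCols (o.sign • M.coeffs o U) 1
  b := o.sign • M.rhs o U
  c := o.sign • Sum.elim (fun _ => 1) (fun _ => 0)

open Classical in
/-- The set `B_η` of columns: all the maybe states, and the slack variables of all the transitions
that are not chosen by `η`. -/
noncomputable def Scheduler.basis {M : MDP S} (η : M.Scheduler) (o : Objective) (U : Set S) :
    Finset (M.Col o U) :=
  Finset.univ.filter (Sum.elim (fun _ => True) (fun μ => η.choice μ.1.1.1 ≠ μ.1.1))

/-- The outcomes of the algorithm on the process `M` and the target set `U`, when `η` is the
scheduler provided by the model checker and the simplex solver moves between bases by `rule`. -/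
def AlgorithmOutcome (M : MDP S) (o : Objective) (U : Set S) (η : M.Scheduler)
    (rule : (M.linProg o U).PivotRule) (r : LinProg.Outcome (M.Col o U)) : Prop :=
  rule.Solves (η.basis o U) r

end MDP

/-!
The probability of reaching `U` under a scheduler `η` is the least nonnegative function that is at
least `1` on `U` and superharmonic for `η` elsewhere (`reachProb_eq_expect` and
`reachProb_le_of_superharmonic`; both come from conditioning on the first step for finite horizons
and passing to the limit). It vanishes on every set outside `U` that `η` does not leave. As the
states at which a subharmonic function attains its maximum form such a set, there is a maximum
principle (`nonpos_of_subharmonic`): if `η` reaches `U` with positive probability from all states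
of `W`, then a function that is subharmonic on `W` and nonpositive elsewhere is nonpositive.

A scheduler that maximizes (minimizes) the sum of the probabilities over all states admits no
improving switch, hence is optimal in all states at once, and the optimal probabilities satisfy
Bellman's inequalities (`exists_isOptimal`). For the maximum, a switch in a single state suffices
as a competitor; for the minimum, there may be sets that another scheduler does not leave, and
then the competitor follows that scheduler on the whole set.

The optimal probabilities `v` are therefore feasible for the linear program. The maximum principle,
for an optimal scheduler, shows that every feasible point `x` satisfies `v ≤ x` (`x ≤ v` for the
minimum) on the maybe states. So every optimum of the linear program agrees with `v` there, and by
weak duality a feasible and dual feasible basis induces an optimum, whatever way the solver took to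
it.

For an apt scheduler, the maximum principle says that the matrix `I - P` of its transition
probabilities between maybe states has a nonnegative inverse. Hence its basis is non-singular, and
dual feasible, as the reduced costs of the nonbasic slack variables are the column sums of this
inverse. If the scheduler is optimal, the rows that belong to its choices are tight for `v`, so its
basis induces the solution given by `v`, which is feasible. The existence of this basis is also the
reason why a solver that explores different bases comes to an end.
-/

/-! ### Reachability within finitely many steps -/

namespace MDP

open MeasureTheory ProbabilityTheory

section Measurability

variable {S : Type*} [MeasurableSpace S]

theorem measurable_cons (s : S) :
    Measurable (fun (ω : ℕ → S) (n : ℕ) => (Nat.casesOn n s ω : S)) := by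
  refine measurable_pi_iff.2 fun n => ?_
  cases n with
  | zero => exact measurable_const
  | succ n => exact measurable_pi_apply n

variable [DiscreteMeasurableSpace S]

theorem measurableSet_reach_le (U : Set S) (n : ℕ) :
    MeasurableSet {ω : ℕ → S | ∃ i ≤ n, ω i ∈ U} := by
  have : {ω : ℕ → S | ∃ i ≤ n, ω i ∈ U} = ⋃ i, ⋃ (_ : i ≤ n), (fun ω => ω i) ⁻¹' U := by
    ext ω; simp
  rw [this]
  exact MeasurableSet.iUnion fun i => MeasurableSet.iUnion fun _ =>
    measurable_pi_apply i (MeasurableSet.of_discrete)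

theorem measurableSet_cylinder (a : ℕ → S) (n : ℕ) :
    MeasurableSet {ω : ℕ → S | ∀ i ≤ n, ω i = a i} := by
  have : {ω : ℕ → S | ∀ i ≤ n, ω i = a i} = ⋂ i, ⋂ (_ : i ≤ n), (fun ω => ω i) ⁻¹' {a i} := by
    ext ω; simp
  rw [this]
  exact MeasurableSet.iInter fun i => MeasurableSet.iInter fun _ =>
    measurable_pi_apply i (measurableSet_singleton _)

end Measurability

variable {S : Type*} [Fintype S]

/-- The expectation of `x` at the state to which the transition `μ` leads. -/
noncomputable def expect (μ : S × PMF S) (x : S → ℝ) : ℝ :=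
  ∑ t, (μ.2 t).toReal * x t

theorem sum_toReal_pmf (p : PMF S) : ∑ t, (p t).toReal = 1 := by
  rw [← ENNReal.toReal_sum (fun t _ => p.apply_ne_top t),
    ← tsum_fintype (L := .unconditional S), p.tsum_coe, ENNReal.toReal_one]

theorem expect_mono (μ : S × PMF S) {x y : S → ℝ} (h : ∀ t, x t ≤ y t) :
    expect μ x ≤ expect μ y :=
  Finset.sum_le_sum fun t _ => mul_le_mul_of_nonneg_left (h t) ENNReal.toReal_nonneg

theorem expect_const (μ : S × PMF S) (c : ℝ) : expect μ (fun _ => c) = c := by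
  rw [expect, ← Finset.sum_mul, sum_toReal_pmf, one_mul]

theorem expect_sub (μ : S × PMF S) (x y : S → ℝ) :
    expect μ (fun t => x t - y t) = expect μ x - expect μ y := by
  simp only [expect, mul_sub, Finset.sum_sub_distrib]

theorem expect_const_mul (μ : S × PMF S) (c : ℝ) (x : S → ℝ) :
    expect μ (fun t => c * x t) = c * expect μ x := by
  simp only [expect, Finset.mul_sum]
  exact Finset.sum_congr rfl fun t _ => by ring

theorem expect_congr (μ : S × PMF S) {x y : S → ℝ} (h : ∀ t, μ.2 t ≠ 0 → x t = y t) :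
    expect μ x = expect μ y := by
  refine Finset.sum_congr rfl fun t _ => ?_
  by_cases ht : μ.2 t = 0
  · simp [ht]
  · rw [h t ht]

variable [MeasurableSpace S] [DiscreteMeasurableSpace S] {M : MDP S}

namespace Scheduler

instance (η : M.Scheduler) (s : S) : IsProbabilityMeasure (η.pathMeasure s) := by
  unfold pathMeasure
  infer_instance

/-- Two measures on paths that agree on the sets of all paths with a given initial segment agree
on events that are determined by finitely many states. -/
theorem measure_preimage_frestrictLe_eq {P Q : Measure (ℕ → S)} (n : ℕ)
    (h : ∀ a : ℕ → S, P {ω | ∀ i ≤ n, ω i = a i} = Q {ω | ∀ i ≤ n, ω i = a i})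
    (E : Set ((i : Finset.Iic n) → (fun _ : ℕ => S) i)) :
    P (Preorder.frestrictLe (π := fun _ => S) n ⁻¹' E) =
      Q (Preorder.frestrictLe (π := fun _ => S) n ⁻¹' E) := by
  have hm : Measurable (Preorder.frestrictLe (π := fun _ : ℕ => S) n) := by fun_prop
  have key : P.map (Preorder.frestrictLe (π := fun _ => S) n) =
      Q.map (Preorder.frestrictLe (π := fun _ => S) n) := by
    refine Measure.ext_of_singleton fun b => ?_
    rw [Measure.map_apply hm (measurableSet_singleton _),
      Measure.map_apply hm (measurableSet_singleton _)]
    -- the values of `a` after time `n` do not matter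
    let a : ℕ → S := fun i => if hi : i ≤ n then b ⟨i, Finset.mem_Iic.2 hi⟩
      else b ⟨0, Finset.mem_Iic.2 n.zero_le⟩
    have : Preorder.frestrictLe (π := fun _ => S) n ⁻¹' {b} = {ω | ∀ i ≤ n, ω i = a i} := by
      ext ω
      simp only [Set.mem_preimage, Set.mem_singleton_iff, funext_iff, Set.mem_ofPred_eq]
      constructor
      · intro H i hi
        simpa [a, hi] using H ⟨i, Finset.mem_Iic.2 hi⟩
      · rintro H ⟨i, hi⟩
        have hi' := Finset.mem_Iic.1 hi
        simpa [a, hi'] using H i hi'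
    rw [this, h]
  rw [← Measure.map_apply hm (Set.toFinite E).measurableSet, key,
    Measure.map_apply hm (Set.toFinite E).measurableSet]

theorem ae_apply_zero_eq (η : M.Scheduler) (s : S) : ∀ᵐ ω ∂η.pathMeasure s, ω 0 = s := by
  have h1 : η.pathMeasure s {ω | ∀ i ≤ 0, ω i = s} = 1 := by
    rw [η.pathMeasure_cylinder s (fun _ => s) rfl]; simp
  have h2 := (prob_compl_eq_zero_iff (measurableSet_cylinder (fun _ => s) 0)).2 h1
  filter_upwards [mem_ae_iff.2 (by simpa only [compl_compl] using h2)] with ω hω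
  exact hω 0 le_rfl

theorem pathMeasure_cylinder_of_ne (η : M.Scheduler) {s : S} {a : ℕ → S} (ha : a 0 ≠ s) (n : ℕ) :
    η.pathMeasure s {ω | ∀ i ≤ n, ω i = a i} = 0 := by
  rw [measure_eq_zero_iff_ae_notMem]
  filter_upwards [η.ae_apply_zero_eq s] with ω h0 hω
  exact ha ((hω 0 n.zero_le).symm.trans h0)

/-- The measure that draws a first step from `s` and then a path from the state reached. -/
noncomputable def firstStep (η : M.Scheduler) (s : S) : Measure (ℕ → S) :=
  ∑ t, (η.choice s).2 t • (η.pathMeasure t).map (fun ω n => Nat.casesOn n s ω)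

theorem firstStep_apply (η : M.Scheduler) (s : S) {E : Set (ℕ → S)} (hE : MeasurableSet E) :
    η.firstStep s E = ∑ t, (η.choice s).2 t *
      η.pathMeasure t {ω | (fun n => Nat.casesOn n s ω : ℕ → S) ∈ E} := by
  simp only [firstStep, Measure.finsetSum_apply, Measure.smul_apply, smul_eq_mul,
    Measure.map_apply (measurable_cons s) hE]
  rfl

/-- The path measure satisfies the Markov property at time `1`, here on initial segments. -/
theorem firstStep_cylinder (η : M.Scheduler) (s : S) (a : ℕ → S) (n : ℕ) :
    η.firstStep s {ω | ∀ i ≤ n, ω i = a i} = η.pathMeasure s {ω | ∀ i ≤ n, ω i = a i} := by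
  rw [firstStep_apply _ _ (measurableSet_cylinder a n)]
  simp only [Set.mem_ofPred_eq]
  by_cases ha : a 0 = s
  · rw [η.pathMeasure_cylinder s a ha]
    cases n with
    | zero =>
      have : ∀ ω : ℕ → S, ∀ i ≤ 0, (Nat.casesOn i s ω : S) = a i := by
        intro ω i hi
        obtain rfl : i = 0 := by omega
        exact ha.symm
      have h1 : {ω : ℕ → S | ∀ i ≤ 0, (Nat.casesOn i s ω : S) = a i} = Set.univ :=
        Set.eq_univ_of_forall this
      simp only [h1, measure_univ, mul_one, Finset.range_zero, Finset.prod_empty]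
      rw [← tsum_fintype (L := .unconditional S), PMF.tsum_coe]
    | succ n =>
      have h1 : {ω : ℕ → S | ∀ i ≤ n + 1, (Nat.casesOn i s ω : S) = a i} =
          {ω | ∀ i ≤ n, ω i = a (i + 1)} := by
        ext ω
        constructor
        · intro H i hi
          exact H (i + 1) (by omega)
        · rintro H (_ | i) hi
          · exact ha.symm
          · exact H i (by omega)
      simp only [h1]
      rw [Finset.sum_eq_single (a 1)]
      · rw [η.pathMeasure_cylinder (a 1) (fun i => a (i + 1)) rfl, Finset.prod_range_succ',
          mul_comm, ha]
      · intro t _ ht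
        rw [η.pathMeasure_cylinder_of_ne (a := fun i => a (i + 1)) (Ne.symm ht), mul_zero]
      · simp
  · rw [η.pathMeasure_cylinder_of_ne ha]
    have h1 : {ω : ℕ → S | ∀ i ≤ n, (Nat.casesOn i s ω : S) = a i} = ∅ :=
      Set.eq_empty_of_forall_notMem fun ω H => ha (H 0 n.zero_le).symm
    simp [h1]

/-- The probability of visiting `U` at one of the times `0, …, n`. -/
noncomputable def reachWithin (η : M.Scheduler) (U : Set S) (n : ℕ) (s : S) : ℝ :=
  (η.pathMeasure s).real {ω | ∃ i ≤ n, ω i ∈ U}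

theorem reachWithin_zero_of_notMem (η : M.Scheduler) {U : Set S} {s : S} (hs : s ∉ U) :
    η.reachWithin U 0 s = 0 := by
  rw [reachWithin, measureReal_eq_zero_iff, measure_eq_zero_iff_ae_notMem]
  filter_upwards [η.ae_apply_zero_eq s] with ω h0
  rintro ⟨i, hi, h⟩
  obtain rfl : i = 0 := by omega
  exact hs (h0 ▸ h)

theorem reachWithin_succ (η : M.Scheduler) {U : Set S} {s : S} (hs : s ∉ U) (n : ℕ) :
    η.reachWithin U (n + 1) s = expect (η.choice s) (η.reachWithin U n) := by
  have h0 : {ω : ℕ → S | ∃ i ≤ n + 1, ω i ∈ U} =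
      Preorder.frestrictLe (π := fun _ => S) (n + 1) ⁻¹' {b | ∃ i, b i ∈ U} := by
    ext ω
    simp only [Set.mem_ofPred_eq, Set.mem_preimage]
    constructor
    · rintro ⟨i, hi, h⟩
      exact ⟨⟨i, Finset.mem_Iic.2 hi⟩, h⟩
    · rintro ⟨⟨i, hi⟩, h⟩
      exact ⟨i, Finset.mem_Iic.1 hi, h⟩
  have h1 : η.pathMeasure s {ω | ∃ i ≤ n + 1, ω i ∈ U} =
      η.firstStep s {ω | ∃ i ≤ n + 1, ω i ∈ U} := by
    rw [h0]
    exact measure_preimage_frestrictLe_eq _ (fun a => (η.firstStep_cylinder s a _).symm) _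
  have h2 : {ω : ℕ → S | (fun n => Nat.casesOn n s ω : ℕ → S) ∈
      {ω : ℕ → S | ∃ i ≤ n + 1, ω i ∈ U}} = {ω | ∃ i ≤ n, ω i ∈ U} := by
    ext ω
    constructor
    · rintro ⟨_ | i, hi, h⟩
      · exact absurd h hs
      · exact ⟨i, by omega, h⟩
    · rintro ⟨i, hi, h⟩
      exact ⟨i + 1, by omega, h⟩
  rw [reachWithin, measureReal_def, h1, firstStep_apply _ _ (measurableSet_reach_le U _), h2,
    ENNReal.toReal_sum fun t _ => ENNReal.mul_ne_top (PMF.apply_ne_top _ _) (measure_ne_top _ _)]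
  exact Finset.sum_congr rfl fun t _ => ENNReal.toReal_mul

/-! ### The probability of reaching a set as a least superharmonic function -/

theorem reachProb_nonneg (η : M.Scheduler) (U : Set S) (s : S) : 0 ≤ η.reachProb U s :=
  measureReal_nonneg

theorem reachWithin_le_one (η : M.Scheduler) (U : Set S) (n : ℕ) (s : S) :
    η.reachWithin U n s ≤ 1 :=
  measureReal_le_one

theorem reachProb_of_mem (η : M.Scheduler) {U : Set S} {s : S} (hs : s ∈ U) :
    η.reachProb U s = 1 := by
  have : η.pathMeasure s {ω | ∃ i, ω i ∈ U} = 1 := by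
    refine le_antisymm prob_le_one ?_
    rw [← measure_univ (μ := η.pathMeasure s)]
    refine measure_mono_ae ?_
    filter_upwards [η.ae_apply_zero_eq s] with ω hω _
    exact ⟨0, hω ▸ hs⟩
  rw [reachProb, measureReal_def, this, ENNReal.toReal_one]

open Filter Topology in
theorem tendsto_reachWithin (η : M.Scheduler) (U : Set S) (s : S) :
    Tendsto (fun n => η.reachWithin U n s) atTop (𝓝 (η.reachProb U s)) := by
  have h0 : {ω : ℕ → S | ∃ i, ω i ∈ U} = ⋃ n, {ω : ℕ → S | ∃ i ≤ n, ω i ∈ U} := by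
    ext ω
    simp only [Set.mem_ofPred_eq, Set.mem_iUnion]
    exact ⟨fun ⟨i, h⟩ => ⟨i, i, le_rfl, h⟩, fun ⟨_, i, _, h⟩ => ⟨i, h⟩⟩
  have h1 : Monotone fun n => {ω : ℕ → S | ∃ i ≤ n, ω i ∈ U} :=
    fun m n hmn ω ⟨i, hi, h⟩ => ⟨i, hi.trans hmn, h⟩
  have h2 := tendsto_measure_iUnion_atTop (μ := η.pathMeasure s) h1
  rw [← h0] at h2
  exact (ENNReal.tendsto_toReal (measure_ne_top _ _)).comp h2

/-- The probabilities of reaching `U` are harmonic outside `U`. -/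
theorem reachProb_eq_expect (η : M.Scheduler) {U : Set S} {s : S} (hs : s ∉ U) :
    η.reachProb U s = expect (η.choice s) (η.reachProb U) := by
  have h1 := (η.tendsto_reachWithin U s).comp (Filter.tendsto_add_atTop_nat 1)
  refine tendsto_nhds_unique h1 ?_
  simp only [Function.comp_def, η.reachWithin_succ hs]
  exact tendsto_finsetSum _ fun t _ => (η.tendsto_reachWithin U t).const_mul _

/-- The probabilities of reaching `U` are minimal among the nonnegative superharmonic functions that
are at least `1` on `U`, as those within `n` steps lie below each such function. -/
theorem reachProb_le_of_superharmonic (η : M.Scheduler) {U : Set S} {x : S → ℝ}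
    (h0 : ∀ s, 0 ≤ x s) (hU : ∀ s ∈ U, 1 ≤ x s)
    (hx : ∀ s ∉ U, expect (η.choice s) x ≤ x s) (s : S) : η.reachProb U s ≤ x s := by
  have key : ∀ n s, η.reachWithin U n s ≤ x s := by
    intro n
    induction n with
    | zero =>
      intro s
      by_cases hs : s ∈ U
      · exact (η.reachWithin_le_one U 0 s).trans (hU s hs)
      · rw [η.reachWithin_zero_of_notMem hs]
        exact h0 s
    | succ n ih =>
      intro s
      by_cases hs : s ∈ U
      · exact (η.reachWithin_le_one U _ s).trans (hU s hs)
      · rw [η.reachWithin_succ hs]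
        exact (expect_mono _ ih).trans (hx s hs)
  exact le_of_tendsto' (η.tendsto_reachWithin U s) fun n => key n s

end Scheduler

end MDP

/-! ### Closed sets and the maximum principle -/

namespace MDP

namespace Scheduler

variable {S : Type*} {M : MDP S}

/-- The set `D` is not left under the scheduler `η`. -/
def IsClosed (η : M.Scheduler) (D : Set S) : Prop :=
  ∀ s ∈ D, ∀ t, (η.choice s).2 t ≠ 0 → t ∈ D

open Classical in
/-- The scheduler that follows `η'` on `D` and `η` elsewhere. -/
noncomputable def switch (η η' : M.Scheduler) (D : Set S) : M.Scheduler where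
  choice s := if s ∈ D then η'.choice s else η.choice s
  choice_mem s := by split_ifs <;> exact choice_mem _ _
  choice_source s := by split_ifs <;> exact choice_source _ _

theorem switch_choice_of_mem (η η' : M.Scheduler) {D : Set S} {s : S} (hs : s ∈ D) :
    (η.switch η' D).choice s = η'.choice s := if_pos hs

theorem switch_choice_of_notMem (η η' : M.Scheduler) {D : Set S} {s : S} (hs : s ∉ D) :
    (η.switch η' D).choice s = η.choice s := if_neg hs

theorem exists_choice_eq (η : M.Scheduler) {μ : S × PMF S} (hμ : μ ∈ M.trans) :
    ∃ η' : M.Scheduler, η'.choice μ.1 = μ := by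
  classical
  refine ⟨⟨Function.update η.choice μ.1 μ, fun s => ?_, fun s => ?_⟩, by simp⟩
  all_goals
    rcases eq_or_ne s μ.1 with rfl | hs
    · simp [hμ]
    · simp [Function.update_of_ne hs, η.choice_mem, η.choice_source]

end Scheduler

variable {S : Type*} [Fintype S] {M : MDP S}

/-- A function that attains its maximum at a state and is there at most its expectation after `μ`
attains its maximum at all successors as well. -/
theorem eq_of_le_expect {μ : S × PMF S} {x : S → ℝ} {m : ℝ} (hx : ∀ t, x t ≤ m)
    (hm : m ≤ expect μ x) {t : S} (ht : μ.2 t ≠ 0) : x t = m := by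
  have h0 : ∑ t, (μ.2 t).toReal * (m - x t) = 0 := by
    refine le_antisymm ?_ (Finset.sum_nonneg fun t _ =>
      mul_nonneg ENNReal.toReal_nonneg (sub_nonneg.2 (hx t)))
    change expect μ (fun t => m - x t) ≤ 0
    rw [expect_sub, expect_const]
    exact sub_nonpos.2 hm
  have h1 := (Finset.sum_eq_zero_iff_of_nonneg fun t _ =>
    mul_nonneg ENNReal.toReal_nonneg (sub_nonneg.2 (hx t))).1 h0 t (Finset.mem_univ t)
  have h2 : (μ.2 t).toReal ≠ 0 := ENNReal.toReal_ne_zero.2 ⟨ht, PMF.apply_ne_top _ _⟩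
  linarith [(mul_eq_zero.1 h1).resolve_left h2]

namespace Scheduler

/-- If a function is nonpositive off `W` and subharmonic on `W`, but positive somewhere, then the
states at which it is maximal form a set that is not left. -/
theorem exists_isClosed_of_subharmonic (η : M.Scheduler) {W : Set S} {x : S → ℝ}
    (h0 : ∀ s ∉ W, x s ≤ 0) (hx : ∀ s ∈ W, x s ≤ expect (η.choice s) x) {s : S} (hs : 0 < x s) :
    ∃ D ⊆ W, D.Nonempty ∧ η.IsClosed D ∧ ∃ m > 0, ∀ t ∈ D, x t = m := by
  have : Nonempty S := ⟨s⟩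
  obtain ⟨u, hu⟩ := Finite.exists_max x
  have hW : {t | x t = x u} ⊆ W := fun t ht => by
    by_contra h
    have h1 : x t = x u := ht
    linarith [h0 t h, hu s]
  refine ⟨{t | x t = x u}, hW, ⟨u, rfl⟩, fun t ht t' ht' => ?_, x u, hs.trans_le (hu s),
    fun t ht => ht⟩
  exact eq_of_le_expect hu (ht.symm.le.trans (hx t (hW ht))) ht'

variable [MeasurableSpace S] [DiscreteMeasurableSpace S]

theorem IsClosed.reachProb_eq_zero {η : M.Scheduler} {D U : Set S} (hD : η.IsClosed D)
    (hU : Disjoint D U) {s : S} (hs : s ∈ D) : η.reachProb U s = 0 := by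
  classical
  refine le_antisymm ?_ (η.reachProb_nonneg U s)
  have h := η.reachProb_le_of_superharmonic (U := U) (x := fun t => if t ∈ D then 0 else 1)
    (fun t => by positivity)
    (fun t ht => by rw [if_neg (Set.disjoint_right.1 hU ht)]) (fun t _ => ?_) s
  · simpa [hs] using h
  · by_cases ht : t ∈ D
    · rw [if_pos ht, expect_congr (y := fun _ => 0) _ fun u hu => by rw [if_pos (hD t ht u hu)],
        expect_const]
    · rw [if_neg ht]
      calc _ ≤ expect (η.choice t) (fun _ => 1) :=
            expect_mono _ fun u => by split_ifs <;> norm_num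
        _ = 1 := expect_const _ 1

/-- The maximum principle: if `U` is reached with positive probability from all states in `W`, then
a function that is subharmonic on `W` and nonpositive elsewhere is nonpositive. -/
theorem nonpos_of_subharmonic (η : M.Scheduler) {U W : Set S} (hU : Disjoint W U)
    (hη : ∀ s ∈ W, 0 < η.reachProb U s) {x : S → ℝ} (h0 : ∀ s ∉ W, x s ≤ 0)
    (hx : ∀ s ∈ W, x s ≤ expect (η.choice s) x) (s : S) : x s ≤ 0 := by
  by_contra! hs
  obtain ⟨D, hDW, ⟨t, ht⟩, hD, -⟩ := η.exists_isClosed_of_subharmonic h0 hx hs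
  exact (hη t (hDW ht)).ne' (hD.reachProb_eq_zero (hU.mono_left hDW) ht)

/-! ### Optimal schedulers -/

instance : Finite M.Scheduler :=
  Finite.of_injective (fun η s => (⟨η.choice s, η.choice_mem s⟩ : M.trans)) fun η η' h => by
    cases η
    cases η'
    simp only [mk.injEq]
    funext s
    exact congrArg Subtype.val (congrFun h s)

instance : Nonempty M.Scheduler := by
  choose f hf using M.exists_enabled
  exact ⟨⟨f, fun s => (hf s).1, fun s => (hf s).2⟩⟩

/-- If the probabilities of `η` do not decrease in expectation under `θ`, but those of `θ` are
smaller somewhere, then the reason is a trap of `θ`: a set outside `U` that `θ` does not leave, on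
which the probabilities of `η` are positive and constant. -/
theorem exists_isClosed_of_reachProb_lt (η θ : M.Scheduler) {U : Set S}
    (hsub : ∀ t ∉ U, η.reachProb U t ≤ expect (θ.choice t) (η.reachProb U)) {s : S}
    (hs : θ.reachProb U s < η.reachProb U s) :
    ∃ D, Disjoint D U ∧ D.Nonempty ∧ θ.IsClosed D ∧ ∃ m > 0, ∀ t ∈ D, η.reachProb U t = m := by
  obtain ⟨D, hDU, hne, hD, m, hm, hDm⟩ := θ.exists_isClosed_of_subharmonic (W := Uᶜ)
    (x := fun t => η.reachProb U t - θ.reachProb U t)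
    (fun t ht => by
      have := not_not.1 ht
      rw [η.reachProb_of_mem this, θ.reachProb_of_mem this, sub_self])
    (fun t ht => by
      rw [expect_sub, ← θ.reachProb_eq_expect ht]
      exact sub_le_sub_right (hsub t ht) _) (sub_pos.2 hs)
  have hdisj : Disjoint D U := Set.disjoint_left.2 hDU
  refine ⟨D, hdisj, hne, hD, m, hm, fun t ht => ?_⟩
  have := hDm t ht
  rwa [hD.reachProb_eq_zero hdisj ht, sub_zero] at this

/-- A single switch to a choice of `η'` that improves on `η` with respect to the probabilities of
`η` does not decrease any probability of reaching `U`, and increases one. Note that the state of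
the switch lies on no closed set on which the probabilities of `η` are constant, so the switch does
not create a trap. -/
theorem sum_reachProb_lt_switch (η η' : M.Scheduler) {U : Set S} {s : S} (hs : s ∉ U)
    (h : η.reachProb U s < expect (η'.choice s) (η.reachProb U)) :
    ∑ t, η.reachProb U t < ∑ t, (η.switch η' {s}).reachProb U t := by
  set θ := η.switch η' {s}
  have hθs : θ.choice s = η'.choice s := switch_choice_of_mem η η' (Set.mem_singleton _)
  have hθ : ∀ t ≠ s, θ.choice t = η.choice t := fun t ht => switch_choice_of_notMem η η' ht
  have hsub : ∀ t ∉ U, η.reachProb U t ≤ expect (θ.choice t) (η.reachProb U) := by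
    intro t ht
    rcases eq_or_ne t s with rfl | hts
    · rw [hθs]; exact h.le
    · rw [hθ t hts, ← η.reachProb_eq_expect ht]
  have hle : ∀ t, η.reachProb U t ≤ θ.reachProb U t := by
    intro t
    by_contra! ht
    obtain ⟨D, hdisj, ⟨u, hu⟩, hD, m, hm, hm'⟩ := η.exists_isClosed_of_reachProb_lt θ hsub ht
    have hsD : s ∉ D := by
      intro hsD
      have h1 := hm' s hsD
      rw [← hθs, expect_congr (y := fun _ => m) _ fun t ht => hm' t (hD s hsD t ht),
        expect_const] at h
      exact h.ne h1
    have hDη : η.IsClosed D := fun t ht v hv => by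
      refine hD t ht v ?_
      rwa [hθ t fun e => hsD (e ▸ ht)]
    exact hm.ne' ((hm' u hu).symm.trans (hDη.reachProb_eq_zero hdisj hu))
  refine Finset.sum_lt_sum (fun t _ => hle t) ⟨s, Finset.mem_univ s, ?_⟩
  rw [θ.reachProb_eq_expect hs, hθs]
  exact h.trans_le (expect_mono _ hle)

/-- A scheduler that maximizes the sum of the probabilities cannot be improved by a switch in a
single state, so its probabilities are superharmonic with respect to every scheduler. -/
theorem exists_forall_reachProb_le (M : MDP S) (U : Set S) :
    ∃ η : M.Scheduler, (∀ (η' : M.Scheduler) (s : S), η'.reachProb U s ≤ η.reachProb U s) ∧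
      ∀ (η' : M.Scheduler), ∀ s ∉ U, expect (η'.choice s) (η.reachProb U) ≤ η.reachProb U s := by
  obtain ⟨η, hη⟩ := Finite.exists_max fun η : M.Scheduler => ∑ s, η.reachProb U s
  have hsup : ∀ (η' : M.Scheduler), ∀ s ∉ U,
      expect (η'.choice s) (η.reachProb U) ≤ η.reachProb U s := by
    intro η' s hs
    by_contra! h
    exact (hη _).not_gt (η.sum_reachProb_lt_switch η' hs h)
  exact ⟨η, fun η' => η'.reachProb_le_of_superharmonic (η.reachProb_nonneg U)
    (fun s hs => (η.reachProb_of_mem hs).ge) (hsup η'), hsup⟩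

/-- A scheduler that minimizes the sum of the probabilities cannot be improved by a switch to
another scheduler, neither in a single state nor in a whole set of states that the other scheduler
does not leave. -/
theorem exists_forall_le_reachProb (M : MDP S) (U : Set S) :
    ∃ η : M.Scheduler, (∀ (η' : M.Scheduler) (s : S), η.reachProb U s ≤ η'.reachProb U s) ∧
      ∀ (η' : M.Scheduler), ∀ s ∉ U, η.reachProb U s ≤ expect (η'.choice s) (η.reachProb U) := by
  obtain ⟨η, hη⟩ := Finite.exists_min fun η : M.Scheduler => ∑ s, η.reachProb U s
  -- by minimality, probabilities that do not increase anywhere do not decrease anywhere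
  have hmin : ∀ θ : M.Scheduler,
      (∀ t ∉ U, expect (θ.choice t) (η.reachProb U) ≤ η.reachProb U t) →
      ∀ s, θ.reachProb U s = η.reachProb U s := by
    intro θ hθ s
    have hle := θ.reachProb_le_of_superharmonic (η.reachProb_nonneg U)
      (fun s hs => (η.reachProb_of_mem hs).ge) hθ
    by_contra! hne
    exact (hη θ).not_gt (Finset.sum_lt_sum (fun t _ => hle t)
      ⟨s, Finset.mem_univ s, (hle s).lt_of_ne hne⟩)
  have hsub : ∀ (η' : M.Scheduler), ∀ s ∉ U,
      η.reachProb U s ≤ expect (η'.choice s) (η.reachProb U) := by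
    intro η' s hs
    by_contra! h
    have heq := hmin (η.switch η' {s}) fun t ht => by
      rcases eq_or_ne t s with rfl | hts
      · rw [switch_choice_of_mem η η' (Set.mem_singleton _)]; exact h.le
      · rw [switch_choice_of_notMem η η' (D := {s}) hts, ← η.reachProb_eq_expect ht]
    have h1 := reachProb_eq_expect (η.switch η' {s}) hs
    rw [switch_choice_of_mem η η' (Set.mem_singleton _), heq, funext heq] at h1
    exact h.ne h1.symm
  refine ⟨η, fun η' s => ?_, hsub⟩
  by_contra! hs
  obtain ⟨D, hdisj, ⟨u, hu⟩, hD, m, hm, hm'⟩ :=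
    η.exists_isClosed_of_reachProb_lt η' (hsub η') hs
  -- following `η'` on the trap `D` lowers the probabilities there to `0`
  have heq := hmin (η.switch η' D) fun t ht => by
    by_cases htD : t ∈ D
    · rw [switch_choice_of_mem η η' htD,
        expect_congr (y := fun _ => m) _ fun v hv => hm' v (hD t htD v hv), expect_const, hm' t htD]
    · rw [switch_choice_of_notMem η η' htD, ← η.reachProb_eq_expect ht]
  have hDs : (η.switch η' D).IsClosed D := fun t ht v hv => by
    rw [switch_choice_of_mem η η' ht] at hv
    exact hD t ht v hv
  rw [← hm' u hu, ← heq u, hDs.reachProb_eq_zero hdisj hu] at hm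
  exact lt_irrefl _ hm

/-- Some scheduler is optimal in all states at once, and the optimal probabilities satisfy the
inequalities of Bellman's equation. -/
theorem exists_isOptimal (M : MDP S) (o : Objective) (U : Set S) :
    ∃ η : M.Scheduler, η.IsOptimal o U ∧ ∀ μ ∈ M.trans, μ.1 ∉ U →
      o.sign * expect μ (M.optProb o U) ≤ o.sign * M.optProb o U μ.1 := by
  cases o with
  | max =>
    obtain ⟨η, h1, h2⟩ := exists_forall_reachProb_le M U
    have hopt : η.IsOptimal .max U := fun s => le_antisymm
      (le_ciSup (f := fun η : M.Scheduler => η.reachProb U s) (Set.finite_range _).bddAbove η)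
      (ciSup_le fun η' => h1 η' s)
    refine ⟨η, hopt, fun μ hμ hs => ?_⟩
    obtain ⟨η', hη'⟩ := η.exists_choice_eq hμ
    rw [← funext hopt, ← hη']
    simpa [Objective.sign, η'.choice_source] using h2 η' μ.1 hs
  | min =>
    obtain ⟨η, h1, h2⟩ := exists_forall_le_reachProb M U
    have hopt : η.IsOptimal .min U := fun s => le_antisymm
      (le_ciInf fun η' => h1 η' s)
      (ciInf_le (f := fun η : M.Scheduler => η.reachProb U s) (Set.finite_range _).bddBelow η)
    refine ⟨η, hopt, fun μ hμ hs => ?_⟩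
    obtain ⟨η', hη'⟩ := η.exists_choice_eq hμ
    rw [← funext hopt, ← hη']
    simpa [Objective.sign, η'.choice_source] using h2 η' μ.1 hs

end Scheduler

end MDP

/-! ### Linear programs: basic solutions, duality and runs of the solver -/

namespace LinProg

open scoped Matrix

variable {ι κ : Type*}

open Classical in
/-- The extension by `0` of a vector that is indexed by a set of columns. -/
noncomputable def extendZero (B : Finset κ) (w : B → ℝ) (k : κ) : ℝ :=
  if h : k ∈ B then w ⟨k, h⟩ else 0

theorem extendZero_mem (B : Finset κ) (w : B → ℝ) (k : B) : extendZero B w k = w k := by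
  simp [extendZero]

theorem extendZero_of_notMem {B : Finset κ} (w : B → ℝ) {k : κ} (hk : k ∉ B) :
    extendZero B w k = 0 := by
  simp [extendZero, hk]

section

variable [Fintype κ]

theorem dotProduct_extendZero (B : Finset κ) (a : κ → ℝ) (w : B → ℝ) :
    a ⬝ᵥ extendZero B w = (fun k : B => a k) ⬝ᵥ w := by
  classical
  simp only [dotProduct]
  rw [← Finset.sum_subset B.subset_univ fun k _ hk => by rw [extendZero_of_notMem w hk, mul_zero],
    ← Finset.sum_coe_sort]
  exact Finset.sum_congr rfl fun k _ => by rw [extendZero_mem]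

theorem mulVec_extendZero (P : LinProg ι κ) (B : Finset κ) (w : B → ℝ) :
    P.A *ᵥ extendZero B w = P.cols B *ᵥ w := by
  funext i
  exact dotProduct_extendZero B (P.A i) w

end

variable [Fintype ι] {P : LinProg ι κ}

open Classical in
theorem Basis.cols_mul_inv (B : P.Basis) : P.cols B.1 * B.inv = 1 := B.2.choose_spec.1

open Classical in
theorem Basis.inv_mul_cols (B : P.Basis) : B.inv * P.cols B.1 = 1 := B.2.choose_spec.2

theorem Basis.reducedCost_of_mem (B : P.Basis) {k : κ} (hk : k ∈ B.1) : B.reducedCost k = 0 := by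
  classical
  have h : ((fun j : B.1 => P.c j) ᵥ* B.inv) ᵥ* P.cols B.1 = fun j : B.1 => P.c j := by
    rw [Matrix.vecMul_vecMul, inv_mul_cols, Matrix.vecMul_one]
  exact sub_eq_zero.2 (congrFun h ⟨k, hk⟩).symm

variable [Fintype κ]

/-- A set of as many columns as there are rows is a basis if no non-trivial combination of its
columns vanishes. -/
theorem isBasis_of_injective {B : Finset κ} (e : B ≃ ι)
    (h : ∀ w, P.A *ᵥ extendZero B w = 0 → w = 0) : P.IsBasis B := by
  classical
  let N : Matrix ι ι ℝ := (P.cols B).submatrix id e.symm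
  have hN : ∀ v, N *ᵥ v = P.cols B *ᵥ (v ∘ e) := fun v => by
    rw [Matrix.submatrix_mulVec_equiv]; rfl
  have hu : IsUnit N := by
    rw [← Matrix.mulVec_injective_iff_isUnit]
    refine (injective_iff_map_eq_zero (Matrix.mulVecLin N)).2 fun v hv => ?_
    rw [Matrix.mulVecLin_apply, hN, ← mulVec_extendZero] at hv
    have := h _ hv
    funext i
    simpa using congrFun this (e.symm i)
  have h1 : P.cols B * N⁻¹.submatrix e id = 1 := by
    have h2 : N * N⁻¹ = 1 := Matrix.mul_nonsing_inv _ ((Matrix.isUnit_iff_isUnit_det _).1 hu)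
    have h3 : P.cols B = N.submatrix id e := by
      ext; simp [N]
    rw [h3, Matrix.submatrix_mul_equiv, h2, Matrix.submatrix_id_id]
  refine ⟨N⁻¹.submatrix e id, ?_, ?_⟩
  · convert h1
  · convert (Matrix.mul_eq_one_comm_of_equiv e.symm).1 h1

namespace Basis

theorem solution_eq_of_mulVec_eq (B : P.Basis) {z : κ → ℝ} (hz : P.A *ᵥ z = P.b)
    (h0 : ∀ k ∉ B.1, z k = 0) : B.solution = z := by
  classical
  have h1 : z = extendZero B.1 (fun k => z k) := by
    funext k
    by_cases hk : k ∈ B.1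
    · rw [extendZero, dif_pos hk]
    · rw [extendZero_of_notMem _ hk, h0 k hk]
  have h2 : B.inv *ᵥ P.b = fun k : B.1 => z k := by
    rw [← hz, h1, mulVec_extendZero, Matrix.mulVec_mulVec, inv_mul_cols, Matrix.one_mulVec]
    funext k
    rw [extendZero_mem]
  funext k
  by_cases hk : k ∈ B.1
  · rw [solution, dif_pos hk, h2]
  · rw [solution, dif_neg hk, h0 k hk]

/-- The cost of a solution of the constraints differs from the cost of the multipliers
`c^B B⁻¹` by the reduced costs. -/
theorem cost_eq (B : P.Basis) {z : κ → ℝ} (hz : P.A *ᵥ z = P.b) :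
    P.c ⬝ᵥ z = ((fun j : B.1 => P.c j) ᵥ* B.inv) ⬝ᵥ P.b + B.reducedCost ⬝ᵥ z := by
  have h : B.reducedCost = P.c - ((fun j : B.1 => P.c j) ᵥ* B.inv) ᵥ* P.A := rfl
  rw [h, sub_dotProduct, ← hz, Matrix.dotProduct_mulVec _ P.A z]
  ring

/-- Weak duality: a feasible and dual feasible basis induces an optimal solution. -/
theorem isOptimal_solution (B : P.Basis) (hf : B.IsFeasible) (hd : B.IsDualFeasible) :
    P.IsOptimal B.solution := by
  refine ⟨hf, fun y hy => ?_⟩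
  rw [B.cost_eq hf.1, B.cost_eq hy.1]
  refine add_le_add_right ?_ _
  refine Finset.sum_le_sum fun k _ => ?_
  by_cases hk : k ∈ B.1
  · simp [B.reducedCost_of_mem hk]
  · rw [solution, dif_neg hk, mul_zero]
    exact mul_nonneg (hd k hk) (hy.2 k)

/-- The reduced cost of a column is its cost minus that of the combination of basic columns that
represents it. -/
theorem exists_reducedCost_eq (B : P.Basis) (k : κ) : ∃ w : B.1 → ℝ,
    P.A *ᵥ extendZero B.1 w = (fun i => P.A i k) ∧
    B.reducedCost k = P.c k - P.c ⬝ᵥ extendZero B.1 w := by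
  classical
  refine ⟨B.inv *ᵥ (fun i => P.A i k), ?_, ?_⟩
  · rw [mulVec_extendZero, Matrix.mulVec_mulVec, cols_mul_inv, Matrix.one_mulVec]
  · rw [reducedCost, dotProduct_extendZero, Matrix.dotProduct_mulVec]

end Basis

namespace PivotRule

variable {rule : P.PivotRule}

theorem Run.exists_basis {B : P.Basis} {past : List P.Basis} {x : κ → ℝ} {k : ℕ}
    (h : rule.Run B past x k) :
    ∃ B' : P.Basis, B'.IsFeasible ∧ B'.IsDualFeasible ∧ x = B'.solution := by
  induction h with
  | finish B past hf hd => exact ⟨B, hf, hd, rfl⟩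
  | move _ _ _ _ _ _ ih => exact ih

theorem Run.eq_of_isFeasible {B : P.Basis} (hf : B.IsFeasible) (hd : B.IsDualFeasible)
    {past : List P.Basis} {x : κ → ℝ} {k : ℕ} (h : rule.Run B past x k) :
    x = B.solution ∧ k = 1 := by
  cases h with
  | finish => exact ⟨rfl, rfl⟩
  | move _ _ _ _ hn => exact absurd ⟨hf, hd⟩ hn

/-- A solver that explores different bases finishes if some basis is feasible and dual feasible:
such a basis is never among those it has left, and there are only finitely many bases. -/
theorem IsNonRepeating.exists_run (hr : rule.IsNonRepeating) {B₀ : P.Basis}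
    (hf : B₀.IsFeasible) (hd : B₀.IsDualFeasible) (B : P.Basis) :
    ∃ x k, rule.Run B [] x k := by
  classical
  have key : ∀ (m : ℕ) (B : P.Basis) (past : List P.Basis), (B :: past).Nodup → B₀ ∉ past →
      Fintype.card P.Basis ≤ past.length + m → ∃ x k, rule.Run B past x k := by
    intro m
    induction m with
    | zero =>
      intro B past hnd _ hc
      have := hnd.length_le_card
      simp only [List.length_cons] at this
      omega
    | succ m ih =>
      intro B past hnd h0 hc
      by_cases hB : B.IsFeasible ∧ B.IsDualFeasible
      · exact ⟨_, _, .finish B past hB.1 hB.2⟩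
      · have h1 : B₀ ∉ B :: past := by
          rw [List.mem_cons, not_or]
          exact ⟨fun h => hB (h ▸ ⟨hf, hd⟩), h0⟩
        obtain ⟨x, k, hx⟩ := ih (rule B past) (B :: past)
          (List.nodup_cons.2 ⟨hr B past ⟨B₀, h1⟩, hnd⟩) h1
          (by rw [List.length_cons]; omega)
        exact ⟨x, k + 1, .move B past x k hB hx⟩
  exact key (Fintype.card P.Basis) B [] (List.nodup_singleton B) List.not_mem_nil (by simp)

end PivotRule

end LinProg

/-! ### The linear program of a reachability problem -/

theorem Objective.sign_mul_self (o : Objective) : o.sign * o.sign = 1 := by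
  cases o <;> simp [Objective.sign]

namespace MDP

open scoped Matrix

variable {S : Type*} [Fintype S] [MeasurableSpace S] [DiscreteMeasurableSpace S] {M : MDP S}
  {o : Objective} {U : Set S}

theorem disjoint_maybeStates (M : MDP S) (o : Objective) (U : Set S) :
    Disjoint (M.maybeStates o U) U :=
  Set.disjoint_left.2 fun _ hs hU => hs (Or.inr hU)

theorem optProb_of_mem {s : S} (hs : s ∈ U) : M.optProb o U s = 1 := by
  obtain ⟨η, hη, -⟩ := Scheduler.exists_isOptimal M o U
  rw [← hη s, η.reachProb_of_mem hs]

theorem optProb_eq_zero {s : S} (hs : s ∉ M.maybeStates o U) (hU : s ∉ U) :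
    M.optProb o U s = 0 :=
  (not_not.1 hs).resolve_right hU

theorem Scheduler.IsOptimal.isApt {η : M.Scheduler} (hη : η.IsOptimal o U) : η.IsApt o U :=
  fun s hs => (η.reachProb_nonneg U s).lt_of_ne fun h => hs (Or.inl ((hη s).symm.trans h.symm))

open Classical in
/-- The function on all states that extends a vector indexed by the maybe states by the constant
`c` on `U`, and by `0` on the remaining states. For `c = 1` this turns the inhomogeneous constraints
into statements on expectations, for `c = 0` the homogeneous ones. -/
noncomputable def valuation (c : ℝ) (x : M.Maybe o U → ℝ) (s : S) : ℝ :=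
  if h : s ∈ M.maybeStates o U then x ⟨s, h⟩ else if s ∈ U then c else 0

theorem valuation_maybe (c : ℝ) (x : M.Maybe o U → ℝ) (s : M.Maybe o U) :
    valuation c x s.1 = x s := dif_pos s.2

theorem valuation_zero_of_notMem (x : M.Maybe o U → ℝ) {s : S} (hs : s ∉ M.maybeStates o U) :
    valuation 0 x s = 0 := by
  simp [valuation, hs]

theorem valuation_optProb :
    valuation 1 (fun s : M.Maybe o U => M.optProb o U s.1) = M.optProb o U := by
  funext s
  rw [valuation]
  split_ifs with h hU
  · rfl
  · exact (optProb_of_mem hU).symm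
  · exact (optProb_eq_zero h hU).symm

/-- The maybe state in which the transition of a row is enabled. -/
def source (μ : M.Row o U) : M.Maybe o U := ⟨μ.1.1.1, μ.2⟩

theorem coeffs_mulVec (c : ℝ) (x : M.Maybe o U → ℝ) (μ : M.Row o U) :
    (M.coeffs o U *ᵥ x) μ - c * M.rhs o U μ = expect μ.1.1 (valuation c x) - x (source μ) := by
  classical
  have h1 : expect μ.1.1 (valuation c x) =
      ∑ s : M.Maybe o U, (μ.1.1.2 s.1).toReal * x s +
        (∑ s : S with s ∈ U, (μ.1.1.2 s).toReal) * c := by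
    have h2 := Finset.sum_subtype (p := fun s => s ∈ M.maybeStates o U)
      (F := inferInstanceAs (Fintype (M.Maybe o U)))
      (Finset.univ.filter fun s => s ∈ M.maybeStates o U) (by simp)
      fun t => (μ.1.1.2 t).toReal * valuation c x t
    simp only [valuation_maybe] at h2
    rw [← h2, Finset.sum_mul, Finset.sum_filter, Finset.sum_filter, ← Finset.sum_add_distrib]
    refine Finset.sum_congr rfl fun t _ => ?_
    by_cases ht : t ∈ M.maybeStates o U
    · have := Set.disjoint_left.1 (M.disjoint_maybeStates o U) ht
      simp [ht, this]
    · simp [valuation, ht]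
  have h3 : ∑ s : M.Maybe o U, (if s.1 = μ.1.1.1 then 1 else 0) * x s = x (source μ) := by
    rw [Finset.sum_eq_single (source μ)]
    · simp [source]
    · intro s _ hs
      have h : s.1 ≠ μ.1.1.1 := fun h => hs (Subtype.ext h)
      rw [if_neg h, zero_mul]
    · simp
  have h4 : (M.coeffs o U *ᵥ x) μ =
      ∑ s : M.Maybe o U, (μ.1.1.2 s.1).toReal * x s - x (source μ) := by
    rw [← h3, ← Finset.sum_sub_distrib]
    exact Finset.sum_congr rfl fun s _ => sub_mul _ _ _
  rw [h1, h4, rhs]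
  ring

/-- The defect of a row, with the constraint vector scaled by `c`. -/
theorem linProg_mulVec (c : ℝ) (z : M.Col o U → ℝ) (μ : M.Row o U) :
    ((M.linProg o U).A *ᵥ z) μ - c * (M.linProg o U).b μ =
      o.sign * (expect μ.1.1 (valuation c (z ∘ Sum.inl)) - z (Sum.inl (source μ))) +
        z (Sum.inr μ) := by
  classical
  have h1 : ((M.linProg o U).A *ᵥ z) μ =
      o.sign * (M.coeffs o U *ᵥ (z ∘ Sum.inl)) μ + z (Sum.inr μ) := by
    have : (M.linProg o U).A = Matrix.fromCols (o.sign • M.coeffs o U) 1 := by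
      rw [linProg]
    rw [this, Matrix.fromCols_mulVec, Matrix.one_mulVec, Matrix.smul_mulVec]
    rfl
  have h2 : (M.linProg o U).b μ = o.sign * M.rhs o U μ := rfl
  rw [h1, h2, ← Function.comp_apply (f := z) (g := Sum.inl), ← coeffs_mulVec]
  ring

theorem linProg_mulVec_eq_iff (z : M.Col o U → ℝ) :
    (M.linProg o U).A *ᵥ z = (M.linProg o U).b ↔ ∀ μ : M.Row o U, z (Sum.inr μ) =
      o.sign * (z (Sum.inl (source μ)) - expect μ.1.1 (valuation 1 (z ∘ Sum.inl))) := by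
  rw [funext_iff]
  refine forall_congr' fun μ => ?_
  have := linProg_mulVec 1 z μ
  constructor <;> intro h <;> linarith

theorem linProg_cost (z : M.Col o U → ℝ) :
    (M.linProg o U).c ⬝ᵥ z = o.sign * ∑ s, z (Sum.inl s) := by
  simp [linProg, dotProduct, Fintype.sum_sum_type, Finset.mul_sum]

/-! ### The solution given by the optimal probabilities -/

/-- The solution of the linear program whose entries at the maybe states are the optimal
probabilities. -/
noncomputable def optSolution (M : MDP S) (o : Objective) (U : Set S) : M.Col o U → ℝ :=
  Sum.elim (fun s => M.optProb o U s.1)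
    (fun μ => o.sign * (M.optProb o U μ.1.1.1 - expect μ.1.1 (M.optProb o U)))

theorem optSolution_mulVec :
    (M.linProg o U).A *ᵥ M.optSolution o U = (M.linProg o U).b := by
  rw [linProg_mulVec_eq_iff]
  intro μ
  have : M.optSolution o U ∘ Sum.inl = fun s : M.Maybe o U => M.optProb o U s.1 := rfl
  rw [this, valuation_optProb]
  rfl

theorem isFeasible_optSolution : (M.linProg o U).IsFeasible (M.optSolution o U) := by
  obtain ⟨η, hη, hB⟩ := Scheduler.exists_isOptimal M o U
  refine ⟨optSolution_mulVec, ?_⟩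
  rintro (s | μ)
  · change 0 ≤ M.optProb o U s.1
    rw [← hη]
    exact η.reachProb_nonneg U s
  · have := hB μ.1.1 μ.1.2 (Set.disjoint_left.1 (M.disjoint_maybeStates o U) μ.2)
    change 0 ≤ o.sign * _
    linarith

/-- The row that belongs to the transition which `η` chooses in a maybe state. -/
def Scheduler.row (η : M.Scheduler) (s : M.Maybe o U) : M.Row o U :=
  ⟨⟨η.choice s.1, η.choice_mem s.1⟩, (η.choice_source s.1).symm ▸ s.2⟩

theorem Scheduler.source_row (η : M.Scheduler) (s : M.Maybe o U) : source (η.row s) = s :=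
  Subtype.ext (η.choice_source s.1)

/-- The optimal probabilities are extremal among all feasible points: the signed difference is
subharmonic with respect to an optimal scheduler, since such a scheduler turns its rows into
equations for the optimal probabilities. -/
theorem sign_mul_optProb_le {z : M.Col o U → ℝ} (hz : (M.linProg o U).IsFeasible z)
    (s : M.Maybe o U) : o.sign * M.optProb o U s.1 ≤ o.sign * z (Sum.inl s) := by
  obtain ⟨η, hη, -⟩ := Scheduler.exists_isOptimal M o U
  have h := η.nonpos_of_subharmonic (M.disjoint_maybeStates o U) hη.isApt
    (x := fun t => o.sign * (M.optProb o U t - valuation 1 (z ∘ Sum.inl) t))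
    (fun t ht => by
      have : valuation 1 (z ∘ Sum.inl) t = M.optProb o U t := by
        rw [← valuation_optProb]
        simp only [valuation, dif_neg ht]
      simp [this])
    (fun t ht => by
      have h1 := (linProg_mulVec_eq_iff z).1 hz.1 (η.row ⟨t, ht⟩)
      rw [η.source_row] at h1
      have h2 := hz.2 (Sum.inr (η.row ⟨t, ht⟩))
      have h3 := η.reachProb_eq_expect (Set.disjoint_left.1 (M.disjoint_maybeStates o U) ht)
      rw [funext hη] at h3
      rw [expect_const_mul, expect_sub, ← h3]
      rw [h1] at h2
      have h4 := valuation_maybe 1 (z ∘ Sum.inl) (⟨t, ht⟩ : M.Maybe o U)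
      rw [h4, Function.comp_apply]
      have h5 : (η.row ⟨t, ht⟩ : M.Row o U).1.1 = η.choice t := rfl
      rw [h5] at h2
      linarith) s.1
  rw [valuation_maybe, Function.comp_apply] at h
  linarith

/-- All optima agree on the maybe states, because the point given by the optimal probabilities is
extremal in every coordinate at once. -/
theorem eq_optProb_of_isOptimal {z : M.Col o U → ℝ} (hz : (M.linProg o U).IsOptimal z)
    (s : M.Maybe o U) : z (Sum.inl s) = M.optProb o U s.1 := by
  have h1 := hz.2 _ isFeasible_optSolution
  rw [linProg_cost, linProg_cost, Finset.mul_sum, Finset.mul_sum] at h1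
  have h2 := (Finset.sum_eq_sum_iff_of_le fun s _ => sign_mul_optProb_le hz.1 s).1
    (le_antisymm (Finset.sum_le_sum fun s _ => sign_mul_optProb_le hz.1 s) h1) s
    (Finset.mem_univ s)
  have h3 : o.sign ≠ 0 := fun h => by simpa [h] using o.sign_mul_self
  exact (mul_left_cancel₀ h3 h2).symm

/-! ### The basis of a scheduler -/

namespace Scheduler

theorem inl_mem_basis (η : M.Scheduler) (s : M.Maybe o U) : Sum.inl s ∈ η.basis o U := by
  simp [basis]

theorem inr_mem_basis_iff (η : M.Scheduler) (μ : M.Row o U) :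
    Sum.inr μ ∈ η.basis o U ↔ η.row (source μ) ≠ μ := by
  simp [basis, row, source, Subtype.ext_iff]

theorem inr_row_notMem_basis (η : M.Scheduler) (s : M.Maybe o U) :
    Sum.inr (η.row s) ∉ η.basis o U := by
  rw [inr_mem_basis_iff, source_row]
  exact not_not.2 rfl

/-- There are as many columns in the basis of a scheduler as there are rows: the column of a maybe
state takes the place of the slack variable of the transition chosen there. -/
noncomputable def basisEquiv (η : M.Scheduler) (o : Objective) (U : Set S) :
    η.basis o U ≃ M.Row o U :=
  Equiv.ofBijective (fun k => Sum.elim η.row id k.1) <| by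
    constructor
    · rintro ⟨s | μ, hk⟩ ⟨s' | μ', hk'⟩ h
      · have h1 : η.row s = η.row s' := h
        rw [Subtype.mk.injEq, ← η.source_row s, h1, source_row]
      · exact absurd hk' ((show η.row s = μ' from h) ▸ η.inr_row_notMem_basis s)
      · exact absurd hk ((show μ = η.row s' from h) ▸ η.inr_row_notMem_basis s')
      · exact Subtype.ext (congrArg Sum.inr h)
    · intro μ
      by_cases h : η.row (source μ) = μ
      · exact ⟨⟨Sum.inl (source μ), η.inl_mem_basis _⟩, h⟩
      · exact ⟨⟨Sum.inr μ, (η.inr_mem_basis_iff μ).2 h⟩, rfl⟩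

/-- If `η` is apt, then a combination of columns of its basis that has nonnegative entries in the
rows of the transitions chosen by `η` has nonpositive signed coefficients at the maybe states. In
other words, `P - I` has a nonpositive inverse, where `P` is the matrix of transition probabilities
between maybe states under `η`. -/
theorem IsApt.sign_mul_nonpos {η : M.Scheduler} (hη : η.IsApt o U) {z : M.Col o U → ℝ}
    (h0 : ∀ k ∉ η.basis o U, z k = 0)
    (hz : ∀ s, 0 ≤ ((M.linProg o U).A *ᵥ z) (η.row s)) (s : M.Maybe o U) :
    o.sign * z (Sum.inl s) ≤ 0 := by
  have h := η.nonpos_of_subharmonic (M.disjoint_maybeStates o U) hη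
    (x := fun t => o.sign * valuation 0 (z ∘ Sum.inl) t)
    (fun t ht => by rw [valuation_zero_of_notMem _ ht, mul_zero])
    (fun t ht => by
      have h1 := linProg_mulVec 0 z (η.row ⟨t, ht⟩)
      have h2 := hz ⟨t, ht⟩
      have h3 := valuation_maybe 0 (z ∘ Sum.inl) (⟨t, ht⟩ : M.Maybe o U)
      have h5 : (η.row ⟨t, ht⟩ : M.Row o U).1.1 = η.choice t := rfl
      rw [η.source_row, h0 _ (η.inr_row_notMem_basis _), h5] at h1
      rw [expect_const_mul, h3, Function.comp_apply]
      linarith) s.1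
  rwa [valuation_maybe] at h

/-- If a combination of the columns in the basis vanishes, then `sign_mul_nonpos` applies to it and
to its negative, so that the coefficients at the maybe states vanish, and then the slack variables. -/
theorem IsApt.isBasis {η : M.Scheduler} (hη : η.IsApt o U) :
    (M.linProg o U).IsBasis (η.basis o U) := by
  refine LinProg.isBasis_of_injective (η.basisEquiv o U) fun w hw => ?_
  set z := LinProg.extendZero (η.basis o U) w with hz
  have h0 : ∀ k ∉ η.basis o U, z k = 0 := fun k hk => LinProg.extendZero_of_notMem w hk
  have h1 := hη.sign_mul_nonpos h0 fun s => by rw [hw]; exact le_rfl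
  have h2 := hη.sign_mul_nonpos (z := -z) (fun k hk => by simp [h0 k hk]) fun s => by
    rw [Matrix.mulVec_neg, hw, neg_zero]; exact le_rfl
  have h3 : ∀ s, z (Sum.inl s) = 0 := fun s => by
    have h4 : o.sign * z (Sum.inl s) = 0 := by
      refine le_antisymm (h1 s) ?_
      have := h2 s
      rw [Pi.neg_apply] at this
      linarith
    calc z (Sum.inl s) = o.sign * (o.sign * z (Sum.inl s)) := by
          rw [← mul_assoc, o.sign_mul_self, one_mul]
      _ = 0 := by rw [h4, mul_zero]
  have h4 : ∀ μ, z (Sum.inr μ) = 0 := fun μ => by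
    have h5 := linProg_mulVec 0 z μ
    have h6 : valuation 0 (z ∘ Sum.inl) = fun _ => 0 := by
      funext t
      simp [valuation, h3]
    rw [hw, h6, expect_const, h3] at h5
    simpa using h5.symm
  funext k
  rw [← LinProg.extendZero_mem _ w k, ← hz]
  rcases k with ⟨s | μ, hk⟩
  · exact h3 s
  · exact h4 μ

/-- The basis of an apt scheduler is dual feasible, even if it is not feasible. -/
theorem IsApt.isDualFeasible {η : M.Scheduler} (hη : η.IsApt o U) :
    LinProg.Basis.IsDualFeasible ⟨η.basis o U, hη.isBasis⟩ := by
  classical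
  rintro (s | μ) hk
  · exact absurd (η.inl_mem_basis s) hk
  · obtain ⟨w, hw, hr⟩ := LinProg.Basis.exists_reducedCost_eq
      (⟨η.basis o U, hη.isBasis⟩ : (M.linProg o U).Basis) (Sum.inr μ)
    have hc : (M.linProg o U).c (Sum.inr μ) = 0 := by simp [linProg]
    rw [hr, hc, linProg_cost, zero_sub, neg_nonneg, Finset.mul_sum]
    refine Finset.sum_nonpos fun s _ => hη.sign_mul_nonpos
      (fun k hk => LinProg.extendZero_of_notMem w hk) (fun s => ?_) s
    rw [hw]
    simp only [linProg, Matrix.fromCols_apply_inr, Matrix.one_apply]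
    split_ifs <;> norm_num

theorem IsOptimal.solution_eq {η : M.Scheduler} (hη : η.IsOptimal o U) :
    LinProg.Basis.solution ⟨η.basis o U, hη.isApt.isBasis⟩ = M.optSolution o U := by
  refine LinProg.Basis.solution_eq_of_mulVec_eq _ optSolution_mulVec ?_
  rintro (s | μ) hk
  · exact absurd (η.inl_mem_basis s) hk
  · have h1 : η.row (source μ) = μ := not_not.1 fun h => hk ((η.inr_mem_basis_iff μ).2 h)
    have h2 : η.choice μ.1.1.1 = μ.1.1 := congrArg (fun ν : M.Row o U => ν.1.1) h1
    have h3 := η.reachProb_eq_expect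
      (Set.disjoint_left.1 (M.disjoint_maybeStates o U) μ.2)
    rw [funext hη, h2] at h3
    change o.sign * (_ - _) = 0
    rw [← h3, sub_self, mul_zero]

theorem IsOptimal.isFeasible {η : M.Scheduler} (hη : η.IsOptimal o U) :
    LinProg.Basis.IsFeasible ⟨η.basis o U, hη.isApt.isBasis⟩ := by
  rw [LinProg.Basis.IsFeasible, hη.solution_eq]
  exact isFeasible_optSolution

end Scheduler

theorem AlgorithmOutcome.isOptimal {η : M.Scheduler} {rule : (M.linProg o U).PivotRule}
    {x : M.Col o U → ℝ} {k : ℕ} (h : M.AlgorithmOutcome o U η rule (.value x k)) :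
    (M.linProg o U).IsOptimal x := by
  cases h with
  | value hB _ _ h =>
    obtain ⟨B, hf, hd, rfl⟩ := h.exists_basis
    exact B.isOptimal_solution hf hd

end MDP

theorem mainTheorem3 {S : Type*} [Fintype S] [MeasurableSpace S] [DiscreteMeasurableSpace S]
    (M : MDP S) (U : Set S) (o : Objective) (η : M.Scheduler)
    (rule : (M.linProg o U).PivotRule) :
    -- every returned value is the vector of optimal probabilities on the maybe states
    (∀ x k, M.AlgorithmOutcome o U η rule (.value x k) →
      ∀ s : M.Maybe o U, x (Sum.inl s) = M.optProb o U s.1) ∧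
    -- an apt scheduler yields a basis, and the algorithm returns an optimum of the linear program
    (η.IsApt o U →
      (M.linProg o U).IsBasis (η.basis o U) ∧
      ¬ M.AlgorithmOutcome o U η rule .singular ∧
      (∀ x k, M.AlgorithmOutcome o U η rule (.value x k) → (M.linProg o U).IsOptimal x) ∧
      (rule.IsNonRepeating → ∃ x k, M.AlgorithmOutcome o U η rule (.value x k))) ∧
    -- an optimal scheduler yields a feasible and dual feasible basis, so the solver stops at once
    (η.IsOptimal o U →
      ∃ hB : (M.linProg o U).IsBasis (η.basis o U),
        LinProg.Basis.IsFeasible ⟨η.basis o U, hB⟩ ∧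
        LinProg.Basis.IsDualFeasible ⟨η.basis o U, hB⟩ ∧
        ∀ r, M.AlgorithmOutcome o U η rule r ↔
          r = .value (LinProg.Basis.solution ⟨η.basis o U, hB⟩) 1) := by
  refine ⟨fun x k h s => MDP.eq_optProb_of_isOptimal h.isOptimal s,
    fun hη => ⟨hη.isBasis, ?_, fun x k h => h.isOptimal, fun hr => ?_⟩,
    fun hη => ⟨hη.isApt.isBasis, hη.isFeasible, hη.isApt.isDualFeasible, fun r => ⟨?_, ?_⟩⟩⟩
  · rintro ⟨⟩
    exact absurd hη.isBasis ‹_›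
  -- the basis of an optimal scheduler is one at which the solver stops
  · obtain ⟨η', hη', -⟩ := MDP.Scheduler.exists_isOptimal M o U
    obtain ⟨x, k, h⟩ := hr.exists_run hη'.isFeasible hη'.isApt.isDualFeasible
      ⟨η.basis o U, hη.isBasis⟩
    exact ⟨x, k, .value hη.isBasis x k h⟩
  · rintro (⟨hB, x, k, h⟩ | h)
    · obtain ⟨rfl, rfl⟩ := h.eq_of_isFeasible hη.isFeasible hη.isApt.isDualFeasible
      rfl
    · exact absurd hη.isApt.isBasis h
  · rintro rfl
    exact .value hη.isApt.isBasis _ _ (.finish _ _ hη.isFeasible hη.isApt.isDualFeasible)
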